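/- Let $n$ be a positive integer, let $A\in\mathbb C^{n\times n}$ be Schur stable (all its eigenvalues lie in the open unit disc) and let $B\in\mathbb C^{n\times 1}$ be such that the pair $(A,B)$ is reachable, i.e. $\operatorname{rank}[B,AB,\dots,A^{n-1}B]=n$. Put $G_\theta:=(e^{\mathrm i\theta}I-A)^{-1}B$. Let $\Psi$ be a continuous, strictly positive function on the unit circle, write $\Psi_\theta:=\Psi(e^{\mathrm i\theta})$, and assume $\int_{-\pi}^{\pi}\Psi_\theta\,\frac{d\theta}{2\pi}=1$. Let $\mathfrak S_n$ be the set of positive semidefinite Hermitian $n\times n$ matrices of trace one, and for $\Lambda\in\mathfrak S_n$ let $$\Theta(\Lambda):=\int_{-\pi}^{\pi}\Lambda^{1/2}G_\theta\,\frac{\Psi_\theta}{G_\theta^*\Lambda G_\theta}\,G_\theta^*\Lambda^{1/2}\,\frac{d\theta}{2\pi},$$ where $\Lambda^{1/2}$ is the positive semidefinite square root (the integrand is bounded and defined for all but finitely many $\theta\in[-\pi,\pi)$). Let $\mathcal F:=\{\Lambda\in\mathfrak S_n:\Theta(\Lambda)=\Lambda\}$. Then for every $\Lambda_0\in\mathfrak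 S_n$ the trajectory of the Pavon--Ferrante iteration $\Lambda_{k+1}=\Theta(\Lambda_k)$, $k\ge 0$, converges to the set $\mathcal F$: $\mathcal F$ is non-empty and $\lim_{k\to\infty}\inf_{\Lambda\in\mathcal F}\|\Lambda_k-\Lambda\|_{\mathrm F}=0$, where $\|X\|_{\mathrm F}=\sqrt{\operatorname{tr}(XX^*)}$. -/

import Mathlib

open scoped MatrixOrder ComplexOrder

noncomputable section

namespace PavonFerrante

variable {n : ℕ}

/-- `A` is Schur stable: all its eigenvalues lie strictly inside the unit circle. -/
def SchurStable (A : Matrix (Fin n) (Fin n) ℂ) : Prop :=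
  ∀ μ ∈ spectrum ℂ A, ‖μ‖ < 1

/-- The pair `(A, B)` is reachable: the matrix `[B, A B, …, A ^ (n - 1) B]` has rank `n`. -/
def Reachable (A : Matrix (Fin n) (Fin n) ℂ) (B : Fin n → ℂ) : Prop :=
  (Matrix.of fun i k : Fin n => ((A ^ (k : ℕ)).mulVec B) i).rank = n

/-- The transfer function `G(z) = (z I - A)⁻¹ B`, a column vector. -/
def transfer (A : Matrix (Fin n) (Fin n) ℂ) (B : Fin n → ℂ) (z : ℂ) : Fin n → ℂ :=
  ((z • (1 : Matrix (Fin n) (Fin n) ℂ) - A)⁻¹).mulVec B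

/-- The value `G_θ = G(e^{jθ})` of the transfer function on the unit circle. -/
def transferCircle (A : Matrix (Fin n) (Fin n) ℂ) (B : Fin n → ℂ) (θ : ℝ) : Fin n → ℂ :=
  transfer A B (Circle.exp θ : ℂ)

/-- `Ψ` is a continuous, strictly positive spectral density on the unit circle, with integral
one with respect to the normalized Lebesgue measure. -/
structure IsNormalizedDensity (Ψ : Circle → ℝ) : Prop where
  continuous : Continuous Ψ
  pos : ∀ z, 0 < Ψ z
  integral_eq_one : (2 * Real.pi)⁻¹ * ∫ θ in (-Real.pi)..Real.pi, Ψ (Circle.exp θ) = 1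

/-- The set `𝔖ₙ` of positive semidefinite `n × n` matrices of unit trace. -/
def densityMatrices (n : ℕ) : Set (Matrix (Fin n) (Fin n) ℂ) :=
  {L | L.PosSemidef ∧ L.trace = 1}

/-- The scalar `G_θ* Λ G_θ`. -/
def quadForm (A : Matrix (Fin n) (Fin n) ℂ) (B : Fin n → ℂ) (L : Matrix (Fin n) (Fin n) ℂ)
    (θ : ℝ) : ℂ :=
  star (transferCircle A B θ) ⬝ᵥ L.mulVec (transferCircle A B θ)

/-- The integrand `Λ^{1/2} G_θ (Ψ_θ / (G_θ* Λ G_θ)) G_θ* Λ^{1/2}` of the iteration map.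
For stable, reachable `(A, B)` and `Λ ∈ 𝔖ₙ` the denominator vanishes for at most finitely many
`θ ∈ [-π, π)`, so its value there does not influence the integral. -/
def integrand (A : Matrix (Fin n) (Fin n) ℂ) (B : Fin n → ℂ) (Ψ : Circle → ℝ)
    (L : Matrix (Fin n) (Fin n) ℂ) (θ : ℝ) : Matrix (Fin n) (Fin n) ℂ :=
  ((Ψ (Circle.exp θ) : ℂ) / quadForm A B L θ) •
    (CFC.sqrt L *
      Matrix.vecMulVec (transferCircle A B θ) (star (transferCircle A B θ)) * CFC.sqrt L)

/-- The iteration map `Θ(Λ) = ∫ Λ^{1/2} G_θ (Ψ_θ / (G_θ* Λ G_θ)) G_θ* Λ^{1/2}`, the (entrywise)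
integral over the unit circle with respect to the normalized Lebesgue measure `dθ / 2π`. -/
def iterMap (A : Matrix (Fin n) (Fin n) ℂ) (B : Fin n → ℂ) (Ψ : Circle → ℝ)
    (L : Matrix (Fin n) (Fin n) ℂ) : Matrix (Fin n) (Fin n) ℂ :=
  Matrix.of fun i j =>
    (2 * (Real.pi : ℂ))⁻¹ * ∫ θ in (-Real.pi)..Real.pi, integrand A B Ψ L θ i j

/-- The set `𝓕 = {Λ ∈ 𝔖ₙ : Θ(Λ) = Λ}` of fixed points. -/
def fixedPointSet (A : Matrix (Fin n) (Fin n) ℂ) (B : Fin n → ℂ) (Ψ : Circle → ℝ) :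
    Set (Matrix (Fin n) (Fin n) ℂ) :=
  {L | L ∈ densityMatrices n ∧ iterMap A B Ψ L = L}

/-- The Frobenius norm `‖X‖_F = (tr (X X*))^{1/2}`. -/
def frobNorm (X : Matrix (Fin n) (Fin n) ℂ) : ℝ :=
  Real.sqrt (X * X.conjTranspose).trace.re

/-- The sequence `u` converges to the set `S`: the Frobenius distance of `u k` from `S` tends to
zero. (In particular `S` has to be non-empty.) -/
def ConvergesToSet (u : ℕ → Matrix (Fin n) (Fin n) ℂ) (S : Set (Matrix (Fin n) (Fin n) ℂ)) :
    Prop :=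
  ∀ ε : ℝ, 0 < ε → ∃ K : ℕ, ∀ k : ℕ, K ≤ k → ∃ L ∈ S, frobNorm (u k - L) < ε

end PavonFerrante

end

namespace PavonFerrante

open Matrix

/-! ### Matrix equations for pairs of positive semidefinite matrices. -/

section LinearAlgebra

variable {m : Type*} [Fintype m]

/-! Absorb `Ψ` into the probability measure `Ψ dθ/2π`, and write `E` for its mean. With `P =
Λ^{1/2}`, the matrix `Θ(Λ)` is the mean of the orthogonal projections onto the lines spanned by `P
G`; let `Q` be its square root. The mean logarithm `E log |P G|²` is a Lyapunov function, because `E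
(|P G|²/|Q G|²) ≤ 1` and `log y ≤ y - 1`.

That inequality comes from a matrix `K` such that `Q K P` has Hermitian part `P²` and `tr (K* K Q²)
≤ tr P² = 1` (`exists_mul_mul_hermitian_part_eq`, by way of a Lyapunov equation). The first property
gives `|P v|² = Re ⟪Q v, K P v⟫`, so by Cauchy–Schwarz `|P G|²/|Q G|² ≤ |K P G|²/|P G|²`, whose mean
is `tr (K* K Q²)`. If `|P G| = |Q G|` almost everywhere, then equality holds throughout, so `Q G = K
P G` almost everywhere; nondegeneracy of `G` gives `Q = K P`, and the Hermitian part identity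
becomes `Q² = P²`.

Along a trajectory the Lyapunov function increases and is bounded, so its increments tend to zero.
Fatou's lemma passes this to limits `R`, `S` of consecutive square roots: `|R G| = |S G|` almost
everywhere, so `R²` is a fixed point. Compactness then gives convergence to the fixed point set.
Reachability enters through the nondegeneracy of `G`: a nontrivial functional of it has finitely
many zeros on the circle. -/

lemma re_trace_conjTranspose_mul_self (X : Matrix m m ℂ) :
    (Xᴴ * X).trace.re = ∑ i, ∑ j, ‖X i j‖ ^ 2 := by
  rw [Finset.sum_comm]
  simp only [trace, diag_apply, mul_apply, conjTranspose_apply, Complex.re_sum]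
  refine Finset.sum_congr rfl fun i _ => Finset.sum_congr rfl fun j _ => ?_
  rw [← Complex.normSq_eq_norm_sq, Complex.star_def, mul_comm, Complex.mul_conj, Complex.ofReal_re]

lemma mul_eq_zero_of_ker_le {P Q X : Matrix m m ℂ} (h : ∀ v, P *ᵥ v = 0 → Q *ᵥ v = 0)
    (hX : P * X = 0) : Q * X = 0 := by
  ext i j
  have := h (X.col j) (by
    ext k; simpa [mulVec, dotProduct, mul_apply] using congrFun (congrFun hX k) j)
  simpa [mulVec, dotProduct, mul_apply] using congrFun this i

variable [DecidableEq m]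

/-- Solution of a Lyapunov equation with diagonal coefficient, with a trace bound. -/
lemma exists_lyapunov_diagonal (ν : m → ℝ) (hν : ∀ i, 0 ≤ ν i) (W : Matrix m m ℂ)
    (hW : W.IsHermitian) :
    let N : Matrix m m ℂ := diagonal fun i => (ν i : ℂ)
    ∃ Y : Matrix m m ℂ, Y.IsHermitian ∧ N * N * Y + Y * (N * N) = (2 : ℂ) • (N * W * N) ∧
      ((N * Y)ᴴ * (N * Y)).trace.re ≤ (N * W * N * W).trace.re := by
  intro N
  -- Entrywise the equation reads `(ν i² + ν j²) Y i j = 2 ν i ν j W i j`. When both `ν` vanish it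
  -- is void, and division by zero yields `c i j = 0`.
  set c : m → m → ℝ := fun i j => 2 * ν i * ν j / (ν i ^ 2 + ν j ^ 2) with hc
  have hcs : ∀ i j, c i j = c j i := fun i j => by
    simp only [hc]; rw [add_comm (ν i ^ 2)]; ring
  have hWn : ∀ i j, ‖W j i‖ = ‖W i j‖ := fun i j => by
    rw [← hW.apply i j, norm_star]
  have hc2 : ∀ i j, c i j * (ν i ^ 2 + ν j ^ 2) = 2 * ν i * ν j := fun i j => by
    simp only [hc]
    by_cases h : ν i ^ 2 + ν j ^ 2 = 0
    · have h1 : ν i = 0 := by nlinarith [sq_nonneg (ν i), sq_nonneg (ν j)]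
      simp [h1]
    · field_simp
  have hc1 : ∀ i j, c i j ≤ 1 := fun i j => by
    simp only [hc]
    by_cases h : ν i ^ 2 + ν j ^ 2 = 0
    · simp [h]
    · have : 0 < ν i ^ 2 + ν j ^ 2 := lt_of_le_of_ne (by positivity) (Ne.symm h)
      rw [div_le_one this]; nlinarith [sq_nonneg (ν i - ν j)]
  refine ⟨of fun i j => (c i j : ℂ) * W i j, ?_, ?_, ?_⟩
  · ext i j
    simp only [conjTranspose_apply, of_apply, star_mul', Complex.star_def, Complex.conj_ofReal]
    rw [hcs, ← Complex.star_def, hW.apply]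
  · ext i j
    simp only [N, diagonal_mul_diagonal, Matrix.add_apply, diagonal_mul, mul_diagonal, of_apply,
      Matrix.smul_apply, smul_eq_mul]
    have : ((c i j * (ν i ^ 2 + ν j ^ 2) : ℝ) : ℂ) = ((2 * ν i * ν j : ℝ) : ℂ) := by rw [hc2]
    push_cast at this
    linear_combination W i j * this
  · rw [re_trace_conjTranspose_mul_self]
    have e1 : ∀ i j, ‖(N * of fun i j => (c i j : ℂ) * W i j) i j‖ ^ 2
        = ν i ^ 2 * (c i j ^ 2 * ‖W i j‖ ^ 2) := fun i j => by
      simp only [N, diagonal_mul, of_apply, norm_mul, Complex.norm_real, Real.norm_eq_abs, mul_pow,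
        sq_abs]
    have e2 : (N * W * N * W).trace.re = ∑ i, ∑ j, ν i * ν j * ‖W i j‖ ^ 2 := by
      simp only [trace, diag_apply, mul_apply (M := N * W * N), Complex.re_sum]
      refine Finset.sum_congr rfl fun i _ => Finset.sum_congr rfl fun j _ => ?_
      simp only [N, mul_diagonal, diagonal_mul]
      rw [← hW.apply j i]
      have : (ν i : ℂ) * W i j * ν j * star (W i j) = ((ν i * ν j * ‖W i j‖ ^ 2 : ℝ) : ℂ) := by
        rw [← Complex.normSq_eq_norm_sq]
        push_cast
        rw [Complex.star_def, ← Complex.mul_conj]; ring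
      rw [this, Complex.ofReal_re]
    rw [e2]
    simp only [e1]
    set s := ∑ i, ∑ j, ν i ^ 2 * (c i j ^ 2 * ‖W i j‖ ^ 2) with hs
    -- Averaging `s` with its transpose replaces `ν i²` by `(ν i² + ν j²)/2`, which cancels one
    -- factor `c i j`; the other is at most one.
    have hs' : s = ∑ i, ∑ j, ν j ^ 2 * (c i j ^ 2 * ‖W i j‖ ^ 2) := by
      rw [hs, Finset.sum_comm]
      refine Finset.sum_congr rfl fun i _ => Finset.sum_congr rfl fun j _ => ?_
      rw [hcs, hWn]
    have h2 : s + s = ∑ i, ∑ j, 2 * (c i j * (ν i * ν j * ‖W i j‖ ^ 2)) := by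
      nth_rewrite 2 [hs']
      rw [hs, ← Finset.sum_add_distrib]
      refine Finset.sum_congr rfl fun i _ => ?_
      rw [← Finset.sum_add_distrib]
      refine Finset.sum_congr rfl fun j _ => ?_
      linear_combination c i j * ‖W i j‖ ^ 2 * hc2 i j
    have h3 : s + s ≤ ∑ i, ∑ j, 2 * (ν i * ν j * ‖W i j‖ ^ 2) := by
      rw [h2]
      refine Finset.sum_le_sum fun i _ => Finset.sum_le_sum fun j _ => ?_
      have := mul_nonneg (mul_nonneg (hν i) (hν j)) (sq_nonneg ‖W i j‖)
      nlinarith [hc1 i j]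
    simp only [← Finset.mul_sum] at h3
    linarith

lemma exists_unitary_diagonal {N : Matrix m m ℂ} (hN : N.PosSemidef) :
    ∃ (U : Matrix m m ℂ) (ν : m → ℝ), Uᴴ * U = 1 ∧ U * Uᴴ = 1 ∧ (∀ i, 0 ≤ ν i) ∧
      N = U * diagonal (fun i => (ν i : ℂ)) * Uᴴ := by
  refine ⟨hN.isHermitian.eigenvectorUnitary, hN.isHermitian.eigenvalues, ?_, ?_,
    hN.eigenvalues_nonneg, ?_⟩
  · exact Unitary.coe_star_mul_self hN.isHermitian.eigenvectorUnitary
  · exact Unitary.coe_mul_star_self hN.isHermitian.eigenvectorUnitary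
  · exact hN.isHermitian.spectral_theorem

/-- Solution of a Lyapunov equation with positive semidefinite coefficient, with a trace bound. -/
lemma exists_lyapunov {N : Matrix m m ℂ} (hN : N.PosSemidef) {W : Matrix m m ℂ}
    (hW : W.IsHermitian) :
    ∃ Y : Matrix m m ℂ, Y.IsHermitian ∧ N * N * Y + Y * (N * N) = (2 : ℂ) • (N * W * N) ∧
      ((N * Y)ᴴ * (N * Y)).trace.re ≤ (N * W * N * W).trace.re := by
  obtain ⟨U, ν, hU, hU', hν, rfl⟩ := exists_unitary_diagonal hN
  obtain ⟨Y, hY, h1, h2⟩ := exists_lyapunov_diagonal ν hν (Uᴴ * W * U)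
    (isHermitian_conjTranspose_mul_mul U hW)
  set D : Matrix m m ℂ := diagonal fun i => (ν i : ℂ)
  have c1 : ∀ X : Matrix m m ℂ, Uᴴ * (U * X) = X := fun X => by
    rw [← Matrix.mul_assoc, hU, Matrix.one_mul]
  have ct : ∀ X : Matrix m m ℂ, (U * X * Uᴴ).trace = X.trace := fun X => by
    rw [trace_mul_comm, c1]
  refine ⟨U * Y * Uᴴ, isHermitian_mul_mul_conjTranspose U hY, ?_, ?_⟩
  · have := congrArg (fun X => U * X * Uᴴ) h1
    simp only [Matrix.mul_add, Matrix.add_mul, Matrix.mul_smul, Matrix.smul_mul,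
      Matrix.mul_assoc] at this
    simp only [Matrix.mul_assoc, c1, this]
  · have e1 : (U * D * Uᴴ * (U * Y * Uᴴ))ᴴ * (U * D * Uᴴ * (U * Y * Uᴴ))
        = U * ((D * Y)ᴴ * (D * Y)) * Uᴴ := by
      simp only [conjTranspose_mul, conjTranspose_conjTranspose, Matrix.mul_assoc, c1]
    have e2 : (U * D * Uᴴ * W * (U * D * Uᴴ) * W).trace
        = (D * (Uᴴ * W * U) * D * (Uᴴ * W * U)).trace := by
      have : U * D * Uᴴ * W * (U * D * Uᴴ) * W = U * (D * Uᴴ * W * U * D * Uᴴ * W) := by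
        simp only [Matrix.mul_assoc]
      rw [this, trace_mul_comm]
      simp only [Matrix.mul_assoc]
    rw [e1, ct, e2]
    exact h2

/-- A positive semidefinite matrix has a Hermitian generalized inverse commuting with it. -/
lemma exists_generalized_inverse {P : Matrix m m ℂ} (hP : P.PosSemidef) :
    ∃ P' : Matrix m m ℂ, P'.PosSemidef ∧ P * P' = P' * P ∧ P * P' * P = P ∧ P' * P * P' = P' := by
  obtain ⟨U, ν, hU, hU', hν, rfl⟩ := exists_unitary_diagonal hP
  have c1 : ∀ X : Matrix m m ℂ, Uᴴ * (U * X) = X := fun X => by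
    rw [← Matrix.mul_assoc, hU, Matrix.one_mul]
  have c2 : ∀ (f : m → ℂ) (X : Matrix m m ℂ) (g : m → ℂ), diagonal f * (diagonal g * X)
      = diagonal (fun i => f i * g i) * X := fun f X g => by
    rw [← Matrix.mul_assoc, diagonal_mul_diagonal]
  -- Since `0⁻¹ = 0`, inverting the eigenvalues produces the Moore–Penrose inverse.
  refine ⟨U * diagonal (fun i => (((ν i)⁻¹ : ℝ) : ℂ)) * Uᴴ, ?_, ?_, ?_, ?_⟩
  · refine PosSemidef.mul_mul_conjTranspose_same (PosSemidef.diagonal fun i => ?_) U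
    simpa using hν i
  all_goals
    simp only [Matrix.mul_assoc, c1, c2]
    congr 3
    funext i
    by_cases h : (ν i : ℂ) = 0 <;> simp [h]

/-- For positive semidefinite `P`, `Q` with the same kernel there is `K` such that `Q K P` has
Hermitian part `P ^ 2` and `K Q` has Frobenius norm at most that of `P`. -/
lemma exists_mul_mul_hermitian_part_eq {P Q : Matrix m m ℂ} (hP : P.PosSemidef)
    (hQ : Q.PosSemidef) (hker : ∀ v, P *ᵥ v = 0 ↔ Q *ᵥ v = 0) :
    ∃ K : Matrix m m ℂ, Q * K * P + (Q * K * P)ᴴ = (2 : ℂ) • (P * P) ∧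
      (Kᴴ * K * (Q * Q)).trace.re ≤ (P * P).trace.re := by
  obtain ⟨P', hP', p1, p2, p3⟩ := exists_generalized_inverse hP
  obtain ⟨Q', hQ', q1, q2, q3⟩ := exists_generalized_inverse hQ
  have a1 : Q * (P' * P) = Q := by
    have := mul_eq_zero_of_ker_le (X := 1 - P' * P) (fun v => (hker v).1)
      (by rw [Matrix.mul_sub, ← Matrix.mul_assoc, p2, Matrix.mul_one, sub_self])
    rw [Matrix.mul_sub, Matrix.mul_one, sub_eq_zero] at this
    exact this.symm
  have a2 : P * (Q' * Q) = P := by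
    have := mul_eq_zero_of_ker_le (X := 1 - Q' * Q) (fun v => (hker v).2)
      (by rw [Matrix.mul_sub, ← Matrix.mul_assoc, q2, Matrix.mul_one, sub_self])
    rw [Matrix.mul_sub, Matrix.mul_one, sub_eq_zero] at this
    exact this.symm
  have hPH : Pᴴ = P := hP.isHermitian
  have hQH : Qᴴ = Q := hQ.isHermitian
  have hPH' : P'ᴴ = P' := hP'.isHermitian
  have hQH' : Q'ᴴ = Q' := hQ'.isHermitian
  -- `E` is the orthogonal projection onto the range of `P`; the kernels being equal, it is also
  -- that of `Q`, and it acts as the identity for all the computations below.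
  set E := P' * P with hE
  have hEQ : Q' * Q = E := by
    have e1 : E * (Q' * Q) = E := by rw [hE, Matrix.mul_assoc, a2]
    have e2 : Q' * Q * E = Q' * Q := by rw [Matrix.mul_assoc, a1]
    have e3 := congrArg conjTranspose e1
    rw [conjTranspose_mul, conjTranspose_mul, hE, conjTranspose_mul, hPH, hPH', hQH, hQH', p1, q1,
      e2] at e3
    exact e3
  have hEH : Eᴴ = E := by rw [hE, conjTranspose_mul, hPH, hPH', p1]
  have hEQ' : Q * Q' = E := by rw [q1, hEQ]
  have QE : Q * E = Q := a1
  have EQ : E * Q = Q := by rw [← hEQ', q2]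
  have PE : P * E = P := by rw [hE, ← Matrix.mul_assoc, p2]
  have EP : E * P = P := by rw [← p1, p2]
  have hPP' : P * P' = E := p1
  have EQ1 : E * Q' = Q' := by rw [← hEQ, q3]
  have QE1 : Q' * E = Q' := by rw [← hEQ', ← Matrix.mul_assoc, q3]
  -- `N` and `N'` are mutually inverse on the range of `E`, and `Q N' Q = P`.
  set N := Q * P' * Q with hN
  set N' := Q' * P * Q' with hN'
  have NN' : N * N' = E := by
    calc N * N' = Q * P' * (Q * Q') * P * Q' := by simp only [hN, hN', Matrix.mul_assoc]
      _ = Q * (P' * (E * P)) * Q' := by rw [hEQ']; simp only [Matrix.mul_assoc]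
      _ = E := by rw [EP, ← hE, QE, hEQ']
  have N'N : N' * N = E := by
    calc N' * N = Q' * P * (Q' * Q) * P' * Q := by simp only [hN, hN', Matrix.mul_assoc]
      _ = Q' * ((P * E) * P') * Q := by rw [hEQ]; simp only [Matrix.mul_assoc]
      _ = E := by rw [PE, hPP', QE1, hEQ]
  have hNps : N.PosSemidef := by
    have := hP'.mul_mul_conjTranspose_same Q
    rwa [hQH] at this
  have hN'H : N'ᴴ = N' := by
    simp only [hN', conjTranspose_mul, hPH, hQH', Matrix.mul_assoc]
  have hNH : Nᴴ = N := hNps.isHermitian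
  have EN : E * N = N := by rw [hN, ← Matrix.mul_assoc, ← Matrix.mul_assoc, EQ]
  have QN'Q : Q * N' * Q = P := by
    calc Q * N' * Q = (Q * Q') * P * (Q' * Q) := by simp only [hN', Matrix.mul_assoc]
      _ = P := by rw [hEQ, hEQ', EP, PE]
  -- Chosen so that `N W N = Q²`: the Lyapunov equation becomes `N² Y + Y N² = 2 Q²`, and
  -- conjugating it by `Q N'` gives `2 P²` on the right.
  set W := N' * (Q * Q) * N' with hW
  have hWH : W.IsHermitian := by
    simp only [IsHermitian, hW, conjTranspose_mul, hN'H, hQH, Matrix.mul_assoc]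
  have NWN : N * W * N = Q * Q := by
    calc N * W * N = (N * N') * (Q * Q) * (N' * N) := by simp only [hW, Matrix.mul_assoc]
      _ = Q * Q := by rw [NN', N'N, ← Matrix.mul_assoc E, EQ, Matrix.mul_assoc, QE]
  obtain ⟨Y, hY, h1, h2⟩ := exists_lyapunov hNps hWH
  have hYH : Yᴴ = Y := hY
  have PP : Q * N' * (Q * Q) * N' * Q = P * P := by
    calc Q * N' * (Q * Q) * N' * Q = (Q * N' * Q) * (Q * N' * Q) := by
          simp only [Matrix.mul_assoc]
      _ = P * P := by rw [QN'Q]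
  rw [NWN] at h1
  refine ⟨N * Y * Q', ?_, ?_⟩
  · have e : Q * (N * Y * Q') * P = Q * N' * (N * N * Y) * N' * Q := by
      calc Q * (N * Y * Q') * P = Q * (N * Y * Q') * (Q * N' * Q) := by rw [QN'Q]
        _ = Q * N * Y * (Q' * Q) * N' * Q := by simp only [Matrix.mul_assoc]
        _ = Q * N * Y * (E * Q') * P * Q' * Q := by
          rw [hEQ]; simp only [hN', Matrix.mul_assoc]
        _ = Q * (E * N) * Y * N' * Q := by
          rw [EQ1, EN]; simp only [hN', Matrix.mul_assoc]
        _ = Q * N' * (N * N * Y) * N' * Q := by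
          rw [← N'N]; simp only [Matrix.mul_assoc]
    have e' : (Q * N' * (N * N * Y) * N' * Q)ᴴ = Q * N' * (Y * (N * N)) * N' * Q := by
      simp only [conjTranspose_mul, hQH, hN'H, hNH, hYH, Matrix.mul_assoc]
    rw [e, e', ← PP]
    have := congrArg (fun X => Q * N' * X * N' * Q) h1
    simpa only [Matrix.mul_add, Matrix.add_mul, Matrix.mul_smul, Matrix.smul_mul] using this
  · have t1 : ((N * Y * Q')ᴴ * (N * Y * Q') * (Q * Q)).trace
        = ((N * Y * E)ᴴ * (N * Y * E)).trace := by
      have : (N * Y * Q')ᴴ * (N * Y * Q') * (Q * Q)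
          = (Q' * (N * Y)ᴴ * (N * Y) * (Q' * Q)) * Q := by
        rw [conjTranspose_mul (N * Y), hQH']; simp only [Matrix.mul_assoc]
      rw [this, trace_mul_comm, hEQ, conjTranspose_mul (N * Y), hEH, ← hEQ']
      simp only [Matrix.mul_assoc]
    -- Pythagoras for the complementary projections `E` and `1 - E`.
    have t2 : ((N * Y * E)ᴴ * (N * Y * E)).trace.re ≤ ((N * Y)ᴴ * (N * Y)).trace.re := by
      have EE : E * E = E := by nth_rewrite 1 [← hEQ']; rw [Matrix.mul_assoc, QE1, hEQ']
      have : ((N * Y * (1 - E))ᴴ * (N * Y * (1 - E))).trace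
          = ((N * Y)ᴴ * (N * Y)).trace - ((N * Y * E)ᴴ * (N * Y * E)).trace := by
        have x1 : ∀ F : Matrix m m ℂ, Fᴴ = F → F * F = F →
            ((N * Y * F)ᴴ * (N * Y * F)).trace = ((N * Y)ᴴ * (N * Y) * F).trace := by
          intro F hF hFF
          rw [conjTranspose_mul, hF, trace_mul_comm, ← Matrix.mul_assoc, Matrix.mul_assoc _ F F,
            hFF, trace_mul_comm, ← Matrix.mul_assoc]
        rw [x1 E hEH EE, x1 (1 - E) (by simp [hEH])
          (by simp [Matrix.mul_sub, Matrix.sub_mul, EE]), Matrix.mul_sub, Matrix.mul_one, trace_sub]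
      have h0 : 0 ≤ ((N * Y * (1 - E))ᴴ * (N * Y * (1 - E))).trace.re := by
        rw [re_trace_conjTranspose_mul_self]; positivity
      rw [this, Complex.sub_re] at h0
      linarith
    have t3 : (N * W * N * W).trace = (P * P).trace := by
      rw [NWN, hW, ← PP]
      have : Q * Q * (N' * (Q * Q) * N') = Q * (Q * N' * (Q * Q) * N') := by
        simp only [Matrix.mul_assoc]
      rw [this, trace_mul_comm]
    rw [t1, ← t3]
    exact t2.trans h2

end LinearAlgebra

end PavonFerrante

namespace PavonFerrante

open Matrix MeasureTheory Filter Topology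

/-! ### Euclidean norm of complex vectors. -/

section SqNorm

variable {m : Type*} [Fintype m]

/-- The squared Euclidean norm of a complex vector. -/
noncomputable def sqNorm (v : m → ℂ) : ℝ := ∑ i, ‖v i‖ ^ 2

lemma sqNorm_nonneg (v : m → ℂ) : 0 ≤ sqNorm v := Finset.sum_nonneg fun _ _ => sq_nonneg _

lemma sq_norm_le_sqNorm (v : m → ℂ) (i : m) : ‖v i‖ ^ 2 ≤ sqNorm v :=
  Finset.single_le_sum (f := fun i => ‖v i‖ ^ 2) (fun _ _ => sq_nonneg _) (Finset.mem_univ i)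

lemma sqNorm_eq_zero {v : m → ℂ} : sqNorm v = 0 ↔ v = 0 := by
  constructor
  · intro h
    ext i
    have := sq_norm_le_sqNorm v i
    rw [h] at this
    simpa using le_antisymm this (sq_nonneg _)
  · rintro rfl
    simp [sqNorm]

lemma ofReal_sqNorm (v : m → ℂ) : (sqNorm v : ℂ) = star v ⬝ᵥ v := by
  simp only [sqNorm, dotProduct, Pi.star_apply, Complex.ofReal_sum]
  refine Finset.sum_congr rfl fun i _ => ?_
  rw [Complex.star_def, mul_comm, Complex.mul_conj, Complex.normSq_eq_norm_sq]

lemma star_dotProduct_comm (v w : m → ℂ) : star w ⬝ᵥ v = star (star v ⬝ᵥ w) := by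
  rw [← star_dotProduct_star, star_star, dotProduct_comm]

lemma sqNorm_sub (v w : m → ℂ) :
    sqNorm (v - w) = sqNorm v + sqNorm w - 2 * (star v ⬝ᵥ w).re := by
  have h : (sqNorm (v - w) : ℂ) = sqNorm v + sqNorm w - (star v ⬝ᵥ w + star (star v ⬝ᵥ w)) := by
    rw [ofReal_sqNorm, ofReal_sqNorm, ofReal_sqNorm, ← star_dotProduct_comm]
    simp only [star_sub, sub_dotProduct, dotProduct_sub]
    ring
  have := congrArg Complex.re h
  simp only [Complex.ofReal_re, Complex.sub_re, Complex.add_re, Complex.star_def,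
    Complex.conj_re] at this
  linarith

lemma sqNorm_smul (c : ℂ) (v : m → ℂ) : sqNorm (c • v) = ‖c‖ ^ 2 * sqNorm v := by
  simp [sqNorm, mul_pow, Finset.mul_sum]

lemma sq_re_dotProduct_le (v w : m → ℂ) :
    (star v ⬝ᵥ w).re ^ 2 ≤ sqNorm v * sqNorm w := by
  -- Cauchy–Schwarz through the discriminant of `|v - t w|²` as a quadratic in `t`.
  have h : ∀ t : ℝ, 0 ≤ sqNorm w * (t * t) + (-(2 * (star v ⬝ᵥ w).re)) * t + sqNorm v := by
    intro t
    have := sqNorm_nonneg (v - (t : ℂ) • w)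
    rw [sqNorm_sub, sqNorm_smul, dotProduct_smul, smul_eq_mul, Complex.re_ofReal_mul,
      Complex.norm_real, Real.norm_eq_abs, sq_abs] at this
    linarith
  have := discrim_le_zero h
  rw [discrim] at this
  linarith

lemma sq_norm_mul_star_le (v : m → ℂ) (i j : m) : ‖v i * star (v j)‖ ≤ sqNorm v := by
  rw [norm_mul, norm_star]
  nlinarith [sq_norm_le_sqNorm v i, sq_norm_le_sqNorm v j, sq_nonneg (‖v i‖ - ‖v j‖)]

lemma sqNorm_mulVec (K : Matrix m m ℂ) (v : m → ℂ) :
    (sqNorm (K *ᵥ v) : ℂ) = star v ⬝ᵥ (Kᴴ * K) *ᵥ v := by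
  rw [ofReal_sqNorm, star_mulVec, ← dotProduct_mulVec, mulVec_mulVec]

lemma continuous_sqNorm : Continuous (sqNorm : (m → ℂ) → ℝ) := by
  unfold sqNorm; fun_prop

end SqNorm

/-! ### Averaged projections and the monotonicity inequality. -/

section AverageProjection

variable {m Ω : Type*} [Fintype m] [MeasurableSpace Ω]

/-- A bounded measurable vector field none of whose nontrivial linear functionals vanishes on a
set of positive measure, all of them being log-integrable. -/
structure IsNondegenerate (μ : Measure Ω) (G : Ω → m → ℂ) : Prop where
  measurable : Measurable G
  bounded : ∃ C, ∀ ω, sqNorm (G ω) ≤ C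
  ae_ne_zero : ∀ v : m → ℂ, v ≠ 0 → ∀ᵐ ω ∂μ, v ⬝ᵥ G ω ≠ 0
  integrable_log : ∀ v : m → ℂ, v ≠ 0 → Integrable (fun ω => Real.log ‖v ⬝ᵥ G ω‖) μ

/-- The average of the orthogonal projections onto the lines spanned by `P G`. -/
noncomputable def averageProjection (μ : Measure Ω) (G : Ω → m → ℂ) (P : Matrix m m ℂ) :
    Matrix m m ℂ :=
  of fun i j => ∫ ω, (P *ᵥ G ω) i * star ((P *ᵥ G ω) j) / (sqNorm (P *ᵥ G ω) : ℂ) ∂μ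

variable {μ : Measure Ω} {G : Ω → m → ℂ}

lemma measurable_mulVec (hG : Measurable G) (P : Matrix m m ℂ) :
    Measurable fun ω => P *ᵥ G ω :=
  (Continuous.matrix_mulVec continuous_const continuous_id).measurable.comp hG

lemma measurable_sqNorm_mulVec (hG : Measurable G) (P : Matrix m m ℂ) :
    Measurable fun ω => sqNorm (P *ᵥ G ω) :=
  continuous_sqNorm.measurable.comp (measurable_mulVec hG P)

lemma norm_projection_entry_le_one (v : m → ℂ) (i j : m) :
    ‖v i * star (v j) / (sqNorm v : ℂ)‖ ≤ 1 := by
  rw [norm_div, Complex.norm_real, Real.norm_of_nonneg (sqNorm_nonneg v)]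
  exact div_le_one_of_le₀ (sq_norm_mul_star_le v i j) (sqNorm_nonneg v)

lemma measurable_projection_entry (hG : Measurable G) (P : Matrix m m ℂ) (i j : m) :
    Measurable fun ω => (P *ᵥ G ω) i * star ((P *ᵥ G ω) j) / (sqNorm (P *ᵥ G ω) : ℂ) := by
  have h := measurable_pi_iff.1 (measurable_mulVec hG P)
  have hs := Complex.measurable_ofReal.comp (measurable_sqNorm_mulVec hG P)
  exact ((h i).mul (continuous_star.measurable.comp (h j))).div hs

lemma integrable_projection_entry [IsProbabilityMeasure μ] (hG : Measurable G)
    (P : Matrix m m ℂ) (i j : m) :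
    Integrable (fun ω => (P *ᵥ G ω) i * star ((P *ᵥ G ω) j) / (sqNorm (P *ᵥ G ω) : ℂ)) μ :=
  Integrable.of_bound (measurable_projection_entry hG P i j).aestronglyMeasurable 1
    (ae_of_all _ fun _ => norm_projection_entry_le_one _ i j)

lemma dotProduct_mulVec_div_eq_sum (X : Matrix m m ℂ) (v : m → ℂ) (c : ℂ) :
    star v ⬝ᵥ X *ᵥ v / c = ∑ i, ∑ j, X i j * (v j * star (v i) / c) := by
  simp only [dotProduct, mulVec, Finset.sum_div, Finset.mul_sum, Pi.star_apply]
  refine Finset.sum_congr rfl fun i _ => Finset.sum_congr rfl fun j _ => ?_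
  ring

lemma integrable_dotProduct_mulVec_div [IsProbabilityMeasure μ] (hG : Measurable G)
    (P X : Matrix m m ℂ) :
    Integrable (fun ω => star (P *ᵥ G ω) ⬝ᵥ X *ᵥ (P *ᵥ G ω) / (sqNorm (P *ᵥ G ω) : ℂ)) μ := by
  simp only [dotProduct_mulVec_div_eq_sum]
  exact integrable_finsetSum _ fun i _ => integrable_finsetSum _ fun j _ =>
    (integrable_projection_entry hG P j i).const_mul _

lemma trace_mul_averageProjection [IsProbabilityMeasure μ] (hG : Measurable G)
    (P X : Matrix m m ℂ) :
    (X * averageProjection μ G P).trace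
      = ∫ ω, star (P *ᵥ G ω) ⬝ᵥ X *ᵥ (P *ᵥ G ω) / (sqNorm (P *ᵥ G ω) : ℂ) ∂μ := by
  simp only [dotProduct_mulVec_div_eq_sum]
  have h : ∀ i j, Integrable (fun ω => X i j * ((P *ᵥ G ω) j * star ((P *ᵥ G ω) i) /
      (sqNorm (P *ᵥ G ω) : ℂ))) μ := fun i j =>
    (integrable_projection_entry hG P j i).const_mul _
  refine Eq.trans ?_ (integral_finsetSum _ fun i _ => integrable_finsetSum _ fun j _ => h i j).symm
  simp only [trace, diag_apply, mul_apply, averageProjection, of_apply]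
  refine Finset.sum_congr rfl fun i _ => ?_
  refine Eq.trans ?_ (integral_finsetSum _ fun j _ => h i j).symm
  exact Finset.sum_congr rfl fun j _ => (integral_const_mul _ _).symm

lemma integrable_sqNorm_mulVec_div [IsProbabilityMeasure μ] (hG : Measurable G)
    (P K : Matrix m m ℂ) :
    Integrable (fun ω => sqNorm (K *ᵥ (P *ᵥ G ω)) / sqNorm (P *ᵥ G ω)) μ := by
  have := (integrable_dotProduct_mulVec_div (μ := μ) hG P (Kᴴ * K)).re
  refine this.congr (ae_of_all _ fun ω => ?_)
  simp only
  rw [← sqNorm_mulVec, ← Complex.ofReal_div]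
  exact Complex.ofReal_re _

lemma re_trace_mul_averageProjection [IsProbabilityMeasure μ] (hG : Measurable G)
    (P K : Matrix m m ℂ) :
    (Kᴴ * K * averageProjection μ G P).trace.re
      = ∫ ω, sqNorm (K *ᵥ (P *ᵥ G ω)) / sqNorm (P *ᵥ G ω) ∂μ := by
  rw [trace_mul_averageProjection hG]
  simp only [← sqNorm_mulVec, ← Complex.ofReal_div]
  rw [integral_complex_ofReal, Complex.ofReal_re]

lemma sq_norm_dotProduct_div (v w : m → ℂ) (c : ℝ) :
    star w ⬝ᵥ vecMulVec v (star v) *ᵥ w / (c : ℂ) = ((‖star v ⬝ᵥ w‖ ^ 2 / c : ℝ) : ℂ) := by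
  rw [Complex.ofReal_div, ← Complex.normSq_eq_norm_sq, ← Complex.mul_conj, vecMulVec_mulVec,
    dotProduct_smul, star_dotProduct_comm v, Complex.star_def]
  simp [mul_comm]

lemma integrable_sq_norm_dotProduct_div [IsProbabilityMeasure μ] (hG : Measurable G)
    (P : Matrix m m ℂ) (v : m → ℂ) :
    Integrable (fun ω => ‖star v ⬝ᵥ (P *ᵥ G ω)‖ ^ 2 / sqNorm (P *ᵥ G ω)) μ := by
  have := (integrable_dotProduct_mulVec_div (μ := μ) hG P (vecMulVec v (star v))).re
  refine this.congr (ae_of_all _ fun ω => ?_)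
  simp only
  rw [sq_norm_dotProduct_div]
  exact Complex.ofReal_re _

lemma star_dotProduct_averageProjection_mulVec [IsProbabilityMeasure μ] (hG : Measurable G)
    (P : Matrix m m ℂ) (v : m → ℂ) :
    star v ⬝ᵥ averageProjection μ G P *ᵥ v
      = ((∫ ω, ‖star v ⬝ᵥ (P *ᵥ G ω)‖ ^ 2 / sqNorm (P *ᵥ G ω) ∂μ : ℝ) : ℂ) := by
  have h : star v ⬝ᵥ averageProjection μ G P *ᵥ v
      = (vecMulVec v (star v) * averageProjection μ G P).trace := by
    rw [trace_mul_comm, mul_vecMulVec, trace_vecMulVec, dotProduct_comm]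
  rw [h, trace_mul_averageProjection hG, ← integral_complex_ofReal]
  simp only [sq_norm_dotProduct_div]

lemma averageProjection_posSemidef [IsProbabilityMeasure μ] (hG : Measurable G)
    (P : Matrix m m ℂ) : (averageProjection μ G P).PosSemidef := by
  refine PosSemidef.of_dotProduct_mulVec_nonneg ?_ fun v => ?_
  · ext i j
    simp only [averageProjection, conjTranspose_apply, of_apply, Complex.star_def]
    rw [← integral_conj]
    refine integral_congr_ae (ae_of_all _ fun ω => ?_)
    simp [mul_comm]
  · rw [star_dotProduct_averageProjection_mulVec hG]
    exact_mod_cast integral_nonneg fun ω => div_nonneg (sq_nonneg _) (sqNorm_nonneg _)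

lemma row_dotProduct (P : Matrix m m ℂ) (v : m → ℂ) (i : m) : P.row i ⬝ᵥ v = (P *ᵥ v) i := rfl

lemma exists_row_ne_zero {P : Matrix m m ℂ} (h : P ≠ 0) : ∃ i, P.row i ≠ 0 := by
  by_contra! h0
  exact h (by ext i j; exact congrFun (h0 i) j)

lemma eq_zero_of_ae_mulVec_eq_zero [IsProbabilityMeasure μ] (hG : IsNondegenerate μ G)
    {P : Matrix m m ℂ} (h : ∀ᵐ ω ∂μ, P *ᵥ G ω = 0) : P = 0 := by
  by_contra hP
  obtain ⟨i, hi⟩ := exists_row_ne_zero hP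
  have : ∀ᵐ ω ∂μ, False := by
    filter_upwards [h, hG.ae_ne_zero _ hi] with ω h1 h2
    exact h2 (by rw [row_dotProduct, h1]; rfl)
  exact this.exists.elim fun _ => id

lemma ae_sqNorm_mulVec_pos (hG : IsNondegenerate μ G) {P : Matrix m m ℂ} (h : P ≠ 0) :
    ∀ᵐ ω ∂μ, 0 < sqNorm (P *ᵥ G ω) := by
  obtain ⟨i, hi⟩ := exists_row_ne_zero h
  filter_upwards [hG.ae_ne_zero _ hi] with ω h2
  refine lt_of_le_of_ne (sqNorm_nonneg _) fun h0 => h2 ?_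
  rw [row_dotProduct, sqNorm_eq_zero.1 h0.symm]; rfl

/-- `|Q v|²` is the mean of `|⟪P v, G⟫|²/|P G|²`, which by nondegeneracy of `G` vanishes only when
`P v = 0`. This supplies the equality of kernels needed to construct `K`. -/
lemma mulVec_eq_zero_iff_of_mul_self_eq [IsProbabilityMeasure μ] (hG : IsNondegenerate μ G)
    {P Q : Matrix m m ℂ} (hP : P.PosSemidef) (hP0 : P ≠ 0) (hQ : Q.PosSemidef)
    (hQP : Q * Q = averageProjection μ G P) (v : m → ℂ) : P *ᵥ v = 0 ↔ Q *ᵥ v = 0 := by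
  have hPH : Pᴴ = P := hP.isHermitian
  have hQH : Qᴴ = Q := hQ.isHermitian
  have e : sqNorm (Q *ᵥ v) = ∫ ω, ‖star v ⬝ᵥ (P *ᵥ G ω)‖ ^ 2 / sqNorm (P *ᵥ G ω) ∂μ := by
    have := sqNorm_mulVec Q v
    rw [hQH, hQP, star_dotProduct_averageProjection_mulVec hG.measurable] at this
    exact_mod_cast this
  have e1 : ∀ ω, star v ⬝ᵥ (P *ᵥ G ω) = star (P *ᵥ v) ⬝ᵥ G ω := fun ω => by
    rw [dotProduct_mulVec, star_mulVec, hPH]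
  simp only [e1] at e
  constructor
  · intro h
    rw [h] at e
    exact sqNorm_eq_zero.1 (by rw [e]; simp)
  · intro h
    by_contra h0
    rw [h, sqNorm_eq_zero.2 rfl, eq_comm, integral_eq_zero_iff_of_nonneg
      (fun ω => div_nonneg (sq_nonneg _) (sqNorm_nonneg _))] at e
    · have : ∀ᵐ ω ∂μ, False := by
        filter_upwards [e, ae_sqNorm_mulVec_pos hG hP0,
          hG.ae_ne_zero (star (P *ᵥ v)) (by simpa using h0)] with ω h1 h2 h3
        have : 0 < ‖star (P *ᵥ v) ⬝ᵥ G ω‖ ^ 2 / sqNorm (P *ᵥ G ω) :=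
          div_pos (pow_pos (norm_pos_iff.2 h3) 2) h2
        simp only [Pi.zero_apply] at h1
        linarith
      exact this.exists.elim fun _ => id
    · simpa only [e1] using integrable_sq_norm_dotProduct_div (μ := μ) hG.measurable P v

variable [DecidableEq m]

lemma trace_averageProjection [IsProbabilityMeasure μ] (hG : IsNondegenerate μ G)
    {P : Matrix m m ℂ} (h : P ≠ 0) : (averageProjection μ G P).trace = 1 := by
  have := trace_mul_averageProjection (μ := μ) hG.measurable P 1
  rw [Matrix.one_mul] at this
  rw [this, integral_congr_ae (g := fun _ => (1 : ℂ))]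
  · simp
  · filter_upwards [ae_sqNorm_mulVec_pos hG h] with ω hω
    rw [one_mulVec, ← ofReal_sqNorm, div_self]
    exact_mod_cast hω.ne'

/-- If `Q ^ 2` is the image of `P ^ 2` under the iteration map, then some `K` satisfies
`|P v|² = Re ⟪Q v, K P v⟫` for all `v`, while the mean of `|K P G|² / |P G|²` is at most one. -/
lemma exists_sqNorm_sq_le [IsProbabilityMeasure μ] (hG : IsNondegenerate μ G)
    {P Q : Matrix m m ℂ} (hP : P.PosSemidef) (hP1 : (P * P).trace = 1) (hQ : Q.PosSemidef)
    (hQP : Q * Q = averageProjection μ G P) :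
    ∃ K : Matrix m m ℂ, Q * K * P + (Q * K * P)ᴴ = (2 : ℂ) • (P * P) ∧
      (∀ v, (star (Q *ᵥ v) ⬝ᵥ K *ᵥ (P *ᵥ v)).re = sqNorm (P *ᵥ v)) ∧
      ∫ ω, sqNorm (K *ᵥ (P *ᵥ G ω)) / sqNorm (P *ᵥ G ω) ∂μ ≤ 1 := by
  have hP0 : P ≠ 0 := by rintro rfl; simp at hP1
  have hPH : Pᴴ = P := hP.isHermitian
  have hQH : Qᴴ = Q := hQ.isHermitian
  obtain ⟨K, h1, h2⟩ := exists_mul_mul_hermitian_part_eq hP hQ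
    (mulVec_eq_zero_iff_of_mul_self_eq hG hP hP0 hQ hQP)
  refine ⟨K, h1, fun v => ?_, ?_⟩
  · have e1 : star (Q *ᵥ v) ⬝ᵥ K *ᵥ (P *ᵥ v) = star v ⬝ᵥ (Q * K * P) *ᵥ v := by
      rw [star_mulVec, hQH, ← dotProduct_mulVec, mulVec_mulVec, mulVec_mulVec, Matrix.mul_assoc]
    have e2 : star v ⬝ᵥ (Q * K * P)ᴴ *ᵥ v = star (star v ⬝ᵥ (Q * K * P) *ᵥ v) := by
      rw [← star_dotProduct_comm, star_mulVec, ← dotProduct_mulVec]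
    have e3 := congrArg (fun X => (star v ⬝ᵥ X *ᵥ v).re) h1
    simp only [add_mulVec, dotProduct_add, e2, smul_mulVec, dotProduct_smul, Complex.add_re,
      Complex.star_def, Complex.conj_re, smul_eq_mul] at e3
    have e4 := sqNorm_mulVec P v
    rw [hPH] at e4
    rw [← e4, ← Complex.ofReal_ofNat, Complex.re_ofReal_mul, Complex.ofReal_re] at e3
    rw [e1]
    linarith
  · rw [← re_trace_mul_averageProjection hG.measurable, ← hQP]
    simpa [hP1] using h2

/-- The inequality behind monotonicity: if `Q ^ 2` is the image of `P ^ 2` under the iteration map,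
then the mean of `|P G|² / |Q G|²` is at most one. -/
lemma integrable_sqNorm_div_sqNorm_and_integral_le [IsProbabilityMeasure μ]
    (hG : IsNondegenerate μ G) {P Q : Matrix m m ℂ} (hP : P.PosSemidef)
    (hP1 : (P * P).trace = 1) (hQ : Q.PosSemidef) (hQP : Q * Q = averageProjection μ G P) :
    Integrable (fun ω => sqNorm (P *ᵥ G ω) / sqNorm (Q *ᵥ G ω)) μ ∧
      ∫ ω, sqNorm (P *ᵥ G ω) / sqNorm (Q *ᵥ G ω) ∂μ ≤ 1 := by
  obtain ⟨K, -, h2, h3⟩ := exists_sqNorm_sq_le hG hP hP1 hQ hQP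
  -- Cauchy–Schwarz for `|P G|² = Re ⟪Q G, K P G⟫`. Where a denominator vanishes the left side is
  -- `0`.
  have hle : ∀ ω, sqNorm (P *ᵥ G ω) / sqNorm (Q *ᵥ G ω)
      ≤ sqNorm (K *ᵥ (P *ᵥ G ω)) / sqNorm (P *ᵥ G ω) := fun ω => by
    have hc := sq_re_dotProduct_le (Q *ᵥ G ω) (K *ᵥ (P *ᵥ G ω))
    rw [h2] at hc
    have hk := sqNorm_nonneg (K *ᵥ (P *ᵥ G ω))
    rcases (sqNorm_nonneg (P *ᵥ G ω)).eq_or_lt with h | h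
    · rw [← h]; simp
    rcases (sqNorm_nonneg (Q *ᵥ G ω)).eq_or_lt with h' | h'
    · rw [← h', div_zero]; positivity
    rw [div_le_div_iff₀ h' h]
    linarith
  have hi := integrable_sqNorm_mulVec_div (μ := μ) hG.measurable P K
  have hi' : Integrable (fun ω => sqNorm (P *ᵥ G ω) / sqNorm (Q *ᵥ G ω)) μ := by
    refine hi.mono' ((measurable_sqNorm_mulVec hG.measurable P).div
      (measurable_sqNorm_mulVec hG.measurable Q)).aestronglyMeasurable (ae_of_all _ fun ω => ?_)
    rw [Real.norm_of_nonneg (div_nonneg (sqNorm_nonneg _) (sqNorm_nonneg _))]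
    exact hle ω
  exact ⟨hi', (integral_mono hi' hi hle).trans h3⟩

/-- If the quadratic forms of `P ^ 2` and of its image `Q ^ 2` agree almost everywhere along `G`,
then `P ^ 2` is a fixed point. -/
lemma mul_self_eq_of_ae_sqNorm_eq [IsProbabilityMeasure μ]
    (hG : IsNondegenerate μ G) {P Q : Matrix m m ℂ} (hP : P.PosSemidef)
    (hP1 : (P * P).trace = 1) (hQ : Q.PosSemidef) (hQP : Q * Q = averageProjection μ G P)
    (h : ∀ᵐ ω ∂μ, sqNorm (P *ᵥ G ω) = sqNorm (Q *ᵥ G ω)) : Q * Q = P * P := by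
  obtain ⟨K, h1, h2, h3⟩ := exists_sqNorm_sq_le hG hP hP1 hQ hQP
  have hP0 : P ≠ 0 := by rintro rfl; simp at hP1
  have hpos := ae_sqNorm_mulVec_pos hG hP0
  have hi := integrable_sqNorm_mulVec_div (μ := μ) hG.measurable P K
  -- Expand the square: the cross term is `-2 |P G|²` and `|Q G|² = |P G|²`. The right side has mean
  -- at most zero, so the nonnegative left side vanishes almost everywhere.
  have key : ∀ᵐ ω ∂μ, sqNorm (Q *ᵥ G ω - K *ᵥ (P *ᵥ G ω)) / sqNorm (P *ᵥ G ω)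
      = sqNorm (K *ᵥ (P *ᵥ G ω)) / sqNorm (P *ᵥ G ω) - 1 := by
    filter_upwards [h, hpos] with ω hω hω'
    rw [sqNorm_sub, h2, ← hω]
    field_simp
    ring
  have hz : (fun ω => sqNorm (Q *ᵥ G ω - K *ᵥ (P *ᵥ G ω)) / sqNorm (P *ᵥ G ω)) =ᵐ[μ] 0 := by
    rw [← integral_eq_zero_iff_of_nonneg
      (fun ω => div_nonneg (sqNorm_nonneg _) (sqNorm_nonneg _))
      ((hi.sub (integrable_const 1)).congr (key.mono fun ω hω => hω.symm))]
    refine le_antisymm ?_ (integral_nonneg fun ω => div_nonneg (sqNorm_nonneg _) (sqNorm_nonneg _))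
    rw [integral_congr_ae key, integral_sub hi (integrable_const 1)]
    simpa using h3
  have hQK : Q - K * P = 0 := by
    refine eq_zero_of_ae_mulVec_eq_zero hG ?_
    filter_upwards [hz, hpos] with ω hω hω'
    rw [sub_mulVec, ← mulVec_mulVec, ← sqNorm_eq_zero]
    simpa [hω'.ne'] using hω
  have hQH : Qᴴ = Q := hQ.isHermitian
  -- With `K P = Q` the product `Q K P` is `Q²`, already Hermitian.
  rw [Matrix.mul_assoc, ← sub_eq_zero.1 hQK, conjTranspose_mul, hQH, ← two_smul ℂ] at h1
  exact smul_right_injective _ (two_ne_zero (α := ℂ)) h1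

end AverageProjection

end PavonFerrante

namespace PavonFerrante

open Matrix MeasureTheory Filter Topology

/-! ### Lyapunov function and limit points of trajectories. -/

section Dynamics

variable {m Ω : Type*} [Fintype m] [MeasurableSpace Ω] {μ : Measure Ω} {G : Ω → m → ℂ}

lemma sqNorm_mulVec_le (P : Matrix m m ℂ) (v : m → ℂ) :
    sqNorm (P *ᵥ v) ≤ (Pᴴ * P).trace.re * sqNorm v := by
  rw [re_trace_conjTranspose_mul_self, Finset.sum_mul]
  refine Finset.sum_le_sum fun i _ => ?_
  refine le_trans ?_ (Finset.sum_mul_sq_le_sq_mul_sq Finset.univ (fun j => ‖P i j‖)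
    (fun j => ‖v j‖))
  refine pow_le_pow_left₀ (norm_nonneg _) ?_ 2
  refine (norm_sum_le _ _).trans (le_of_eq ?_)
  simp

/-- Boundedness of `G` controls the logarithm from above; from below, one nonzero row of `P`
suffices, its functional being log-integrable. -/
lemma integrable_log_sqNorm_mulVec [IsProbabilityMeasure μ] (hG : IsNondegenerate μ G)
    {P : Matrix m m ℂ} (hP : P ≠ 0) :
    Integrable (fun ω => Real.log (sqNorm (P *ᵥ G ω))) μ := by
  obtain ⟨C, hC⟩ := hG.bounded
  obtain ⟨i, hi⟩ := exists_row_ne_zero hP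
  set D := (Pᴴ * P).trace.re
  have hD : 0 ≤ D := by
    simp only [D]; rw [re_trace_conjTranspose_mul_self]; positivity
  refine Integrable.mono' (((hG.integrable_log _ hi).norm.const_mul 2).add
    (integrable_const (D * C))) (Real.measurable_log.comp
      (measurable_sqNorm_mulVec hG.measurable P)).aestronglyMeasurable ?_
  filter_upwards [hG.ae_ne_zero _ hi] with ω hω
  have h1 := sq_norm_le_sqNorm (P *ᵥ G ω) i
  rw [← row_dotProduct] at h1
  have h0 : 0 < ‖P.row i ⬝ᵥ G ω‖ := norm_pos_iff.2 hω
  have h2 := Real.log_le_log (by positivity) h1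
  rw [Real.log_pow] at h2
  have h3 : Real.log (sqNorm (P *ᵥ G ω)) ≤ D * C :=
    (Real.log_le_self (sqNorm_nonneg _)).trans
      ((sqNorm_mulVec_le P _).trans (mul_le_mul_of_nonneg_left (hC ω) hD))
  have hDC : 0 ≤ D * C := mul_nonneg hD ((sqNorm_nonneg _).trans (hC ω))
  simp only [Pi.add_apply, Real.norm_eq_abs]
  rw [abs_le]
  push_cast at h2
  constructor
  · linarith [neg_abs_le (Real.log ‖P.row i ⬝ᵥ G ω‖)]
  · linarith [abs_nonneg (Real.log ‖P.row i ⬝ᵥ G ω‖)]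

lemma tendsto_sqNorm_mulVec {P : ℕ → Matrix m m ℂ} {R : Matrix m m ℂ}
    (h : Tendsto P atTop (𝓝 R)) (v : m → ℂ) :
    Tendsto (fun k => sqNorm (P k *ᵥ v)) atTop (𝓝 (sqNorm (R *ᵥ v))) :=
  ((continuous_sqNorm.comp (Continuous.matrix_mulVec continuous_id continuous_const)).tendsto
    R).comp h

/-- Projections depend discontinuously on `P` only where `R G = 0`, a null set as `R ≠ 0`; their
entries are bounded by one, so dominated convergence applies. -/
lemma tendsto_averageProjection [IsProbabilityMeasure μ] (hG : IsNondegenerate μ G)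
    {P : ℕ → Matrix m m ℂ} {R : Matrix m m ℂ} (h : Tendsto P atTop (𝓝 R)) (hR : R ≠ 0) :
    Tendsto (fun k => averageProjection μ G (P k)) atTop (𝓝 (averageProjection μ G R)) := by
  refine tendsto_pi_nhds.2 fun i => tendsto_pi_nhds.2 fun j => ?_
  refine tendsto_integral_of_dominated_convergence (fun _ => 1)
    (fun k => (measurable_projection_entry hG.measurable (P k) i j).aestronglyMeasurable)
    (integrable_const 1) (fun k => ae_of_all _ fun ω => norm_projection_entry_le_one _ i j) ?_
  filter_upwards [ae_sqNorm_mulVec_pos hG hR] with ω hω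
  have hv : Tendsto (fun k => P k *ᵥ G ω) atTop (𝓝 (R *ᵥ G ω)) :=
    ((Continuous.matrix_mulVec continuous_id continuous_const).tendsto R).comp h
  have hv' := tendsto_pi_nhds.1 hv
  have hs : Tendsto (fun k => (sqNorm (P k *ᵥ G ω) : ℂ)) atTop (𝓝 (sqNorm (R *ᵥ G ω) : ℂ)) :=
    (Complex.continuous_ofReal.tendsto _).comp (tendsto_sqNorm_mulVec h _)
  exact ((hv' i).mul ((continuous_star.tendsto _).comp (hv' j))).div hs
    (by exact_mod_cast hω.ne')

lemma posSemidef_of_tendsto {P : ℕ → Matrix m m ℂ} {R : Matrix m m ℂ}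
    (h : Tendsto P atTop (𝓝 R)) (hP : ∀ k, (P k).PosSemidef) : R.PosSemidef := by
  refine PosSemidef.of_dotProduct_mulVec_nonneg ?_ fun v => ?_
  · have h1 : Tendsto (fun k => (P k)ᴴ) atTop (𝓝 Rᴴ) :=
      ((Continuous.matrix_conjTranspose continuous_id).tendsto R).comp h
    exact tendsto_nhds_unique (h1.congr fun k => (hP k).isHermitian) h
  · have hc : Continuous fun X : Matrix m m ℂ => star v ⬝ᵥ X *ᵥ v := by fun_prop
    exact ge_of_tendsto' ((hc.tendsto R).comp h) fun k => (hP k).dotProduct_mulVec_nonneg v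

variable [DecidableEq m]

/-- The Lyapunov function of the iteration. -/
noncomputable def meanLog (μ : Measure Ω) (G : Ω → m → ℂ) (P : Matrix m m ℂ) : ℝ :=
  ∫ ω, Real.log (sqNorm (P *ᵥ G ω)) ∂μ

/-- Integrate `y - 1 - log y ≥ 0` and use that `y` has mean at most one. The lower integral is the
form suited to Fatou's lemma. -/
lemma integral_gap_le [IsProbabilityMeasure μ]
    (hG : IsNondegenerate μ G) {P Q : Matrix m m ℂ} (hP : P.PosSemidef)
    (hP1 : (P * P).trace = 1) (hQ : Q.PosSemidef) (hQ1 : (Q * Q).trace = 1)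
    (hQP : Q * Q = averageProjection μ G P) :
    let y := fun ω => sqNorm (P *ᵥ G ω) / sqNorm (Q *ᵥ G ω)
    ∫⁻ ω, ENNReal.ofReal (y ω - 1 - Real.log (y ω)) ∂μ
        ≤ ENNReal.ofReal (meanLog μ G Q - meanLog μ G P) ∧ meanLog μ G P ≤ meanLog μ G Q := by
  intro y
  have hP0 : P ≠ 0 := by rintro rfl; simp at hP1
  have hQ0 : Q ≠ 0 := by rintro rfl; simp at hQ1
  obtain ⟨h1, h2⟩ := integrable_sqNorm_div_sqNorm_and_integral_le hG hP hP1 hQ hQP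
  have hp := ae_sqNorm_mulVec_pos hG hP0
  have hq := ae_sqNorm_mulVec_pos hG hQ0
  have ip := integrable_log_sqNorm_mulVec hG hP0
  have iq := integrable_log_sqNorm_mulVec hG hQ0
  have hlog : (fun ω => Real.log (sqNorm (P *ᵥ G ω)) - Real.log (sqNorm (Q *ᵥ G ω)))
      =ᵐ[μ] fun ω => Real.log (y ω) := by
    filter_upwards [hp, hq] with ω h3 h4
    rw [Real.log_div h3.ne' h4.ne']
  have il : Integrable (fun ω => Real.log (y ω)) μ := (ip.sub iq).congr hlog
  have i1 : Integrable (fun ω => y ω - 1) μ := h1.sub (integrable_const 1)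
  have hnn : 0 ≤ᵐ[μ] fun ω => y ω - 1 - Real.log (y ω) := by
    filter_upwards [hp, hq] with ω h3 h4
    have := Real.log_le_sub_one_of_pos (div_pos h3 h4)
    simp only [Pi.zero_apply, y]
    linarith
  have hle : ∫ ω, (y ω - 1 - Real.log (y ω)) ∂μ ≤ meanLog μ G Q - meanLog μ G P := by
    rw [integral_sub i1 il, integral_sub h1 (integrable_const 1), ← integral_congr_ae hlog,
      integral_sub ip iq]
    simp only [meanLog, integral_const, probReal_univ, smul_eq_mul]
    linarith
  refine ⟨?_, ?_⟩
  · exact (ofReal_integral_eq_lintegral_ofReal (i1.sub il) hnn).symm.le.trans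
      (ENNReal.ofReal_le_ofReal hle)
  · have := integral_nonneg_of_ae hnn
    linarith

/-- Every limit point of a trajectory of square roots is a square root of a fixed point. -/
lemma averageProjection_eq_of_tendsto [IsProbabilityMeasure μ] (hG : IsNondegenerate μ G)
    {P : ℕ → Matrix m m ℂ} (hP : ∀ k, (P k).PosSemidef) (hP1 : ∀ k, (P k * P k).trace = 1)
    (hstep : ∀ k, P (k + 1) * P (k + 1) = averageProjection μ G (P k)) {φ : ℕ → ℕ}
    (hφ : Tendsto φ atTop atTop) {R S : Matrix m m ℂ}
    (hR : Tendsto (fun j => P (φ j)) atTop (𝓝 R))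
    (hS : Tendsto (fun j => P (φ j + 1)) atTop (𝓝 S)) :
    R.PosSemidef ∧ (R * R).trace = 1 ∧ averageProjection μ G R = R * R := by
  have hRp : R.PosSemidef := posSemidef_of_tendsto hR fun j => hP _
  have hSp : S.PosSemidef := posSemidef_of_tendsto hS fun j => hP _
  have tr : ∀ {u : ℕ → ℕ} {T : Matrix m m ℂ}, Tendsto (fun j => P (u j)) atTop (𝓝 T) →
      (T * T).trace = 1 := by
    intro u T hT
    have hc : Continuous fun X : Matrix m m ℂ => (X * X).trace := by fun_prop
    exact tendsto_nhds_unique ((hc.tendsto T).comp hT)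
      (tendsto_const_nhds.congr fun j => (hP1 _).symm)
  have hR1 := tr hR
  have hS1 := tr hS
  have hR0 : R ≠ 0 := by rintro rfl; simp at hR1
  have hS0 : S ≠ 0 := by rintro rfl; simp at hS1
  have hSR : S * S = averageProjection μ G R := by
    have h1 := tendsto_averageProjection hG hR hR0
    have hc : Continuous fun X : Matrix m m ℂ => X * X := by fun_prop
    exact tendsto_nhds_unique ((hc.tendsto S).comp hS) (h1.congr fun j => (hstep _).symm)
  refine ⟨hRp, hR1, ?_⟩
  rw [← hSR]
  refine mul_self_eq_of_ae_sqNorm_eq hG hRp hR1 hSp hSR ?_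
  set I : ℕ → ℝ := fun k => meanLog μ G (P k) with hI
  have hgap := fun k => integral_gap_le hG (hP k) (hP1 k) (hP (k + 1)) (hP1 (k + 1)) (hstep k)
  have hmono : Monotone I := monotone_nat_of_le_succ fun k => (hgap k).2
  have hbdd : BddAbove (Set.range I) := by
    obtain ⟨C, hC⟩ := hG.bounded
    refine ⟨C, ?_⟩
    rintro _ ⟨k, rfl⟩
    have hP0 : P k ≠ 0 := fun h0 => by have := hP1 k; simp [h0] at this
    have := integral_mono (integrable_log_sqNorm_mulVec hG hP0) (integrable_const (μ := μ) C)
      fun ω => by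
        have h1 := sqNorm_mulVec_le (P k) (G ω)
        rw [(hP k).isHermitian.eq, hP1 k, Complex.one_re, one_mul] at h1
        exact (Real.log_le_self (sqNorm_nonneg _)).trans (h1.trans (hC ω))
    simpa [hI, meanLog] using this
  have hlim := tendsto_atTop_ciSup hmono hbdd
  have hdiff : Tendsto (fun j => ENNReal.ofReal (I (φ j + 1) - I (φ j))) atTop (𝓝 0) := by
    have h1 := ((hlim.comp (tendsto_add_atTop_nat 1)).comp hφ).sub (hlim.comp hφ)
    rw [sub_self] at h1
    have := ENNReal.tendsto_ofReal h1
    rwa [ENNReal.ofReal_zero] at this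
  set y : ℕ → Ω → ℝ := fun k ω => sqNorm (P k *ᵥ G ω) / sqNorm (P (k + 1) *ᵥ G ω) with hy
  set z : Ω → ℝ := fun ω => sqNorm (R *ᵥ G ω) / sqNorm (S *ᵥ G ω) with hz
  set g : ℝ → ENNReal := fun t => ENNReal.ofReal (t - 1 - Real.log t) with hg
  have hgm : Measurable g := by
    exact ENNReal.measurable_ofReal.comp
      ((measurable_id.sub_const 1).sub Real.measurable_log)
  have hym : ∀ k, Measurable (y k) := fun k =>
    (measurable_sqNorm_mulVec hG.measurable _).div (measurable_sqNorm_mulVec hG.measurable _)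
  have hzm : Measurable z :=
    (measurable_sqNorm_mulVec hG.measurable _).div (measurable_sqNorm_mulVec hG.measurable _)
  have hpR := ae_sqNorm_mulVec_pos hG hR0
  have hpS := ae_sqNorm_mulVec_pos hG hS0
  have hlimz : ∀ᵐ ω ∂μ, liminf (fun j => g (y (φ j) ω)) atTop = g (z ω) := by
    filter_upwards [hpR, hpS] with ω h1 h2
    have h3 : Tendsto (fun j => y (φ j) ω) atTop (𝓝 (z ω)) :=
      (tendsto_sqNorm_mulVec hR _).div (tendsto_sqNorm_mulVec hS _) h2.ne'
    have h4 : z ω ≠ 0 := (div_pos h1 h2).ne'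
    exact (ENNReal.tendsto_ofReal ((h3.sub_const 1).sub (h3.log h4))).liminf_eq
  -- Fatou's lemma: the gaps are dominated by increments of a convergent sequence. As `t - 1 - log
  -- t` vanishes only at `t = 1`, this forces `z = 1` almost everywhere.
  have hfin : ∫⁻ ω, g (z ω) ∂μ = 0 := by
    rw [← lintegral_congr_ae hlimz]
    refine le_antisymm ((lintegral_liminf_le fun j => hgm.comp (hym (φ j))).trans ?_) zero_le
    have h0 : Tendsto (fun j => ∫⁻ ω, g (y (φ j) ω) ∂μ) atTop (𝓝 0) :=
      tendsto_of_tendsto_of_tendsto_of_le_of_le tendsto_const_nhds hdiff (fun _ => zero_le)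
        fun j => (hgap (φ j)).1
    exact h0.liminf_eq.le
  filter_upwards [(lintegral_eq_zero_iff (hgm.comp hzm)).1 hfin, hpR, hpS] with ω h1 h2 h3
  have hz0 : 0 < z ω := div_pos h2 h3
  by_contra hne
  have hz1 : z ω ≠ 1 := fun h => hne (by simpa [hz, div_eq_one_iff_eq h3.ne'] using h)
  have h4 := Real.log_lt_sub_one_of_pos hz0 hz1
  simp only [hg, Function.comp_apply, Pi.zero_apply, ENNReal.ofReal_eq_zero] at h1
  linarith

/-- A trajectory of square roots is precompact, and its limit points are square roots of fixed
points. -/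
lemma exists_subseq_tendsto_fixedPoint [IsProbabilityMeasure μ] (hG : IsNondegenerate μ G)
    {P : ℕ → Matrix m m ℂ} (hP : ∀ k, (P k).PosSemidef) (hP1 : ∀ k, (P k * P k).trace = 1)
    (hstep : ∀ k, P (k + 1) * P (k + 1) = averageProjection μ G (P k)) {φ : ℕ → ℕ}
    (hφ : StrictMono φ) :
    ∃ (R : Matrix m m ℂ) (ψ : ℕ → ℕ), StrictMono ψ ∧
      Tendsto (fun j => P (φ (ψ j))) atTop (𝓝 R) ∧
      R.PosSemidef ∧ (R * R).trace = 1 ∧ averageProjection μ G R = R * R := by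
  let K : Set (Matrix m m ℂ) :=
    Set.univ.pi fun _ : m => Set.univ.pi fun _ : m => Metric.closedBall (0 : ℂ) 1
  have hK : IsCompact K :=
    isCompact_univ_pi fun _ => isCompact_univ_pi fun _ => isCompact_closedBall _ _
  have hmem : ∀ k, P k ∈ K := by
    intro k i _ j _
    have h := re_trace_conjTranspose_mul_self (P k)
    rw [(hP k).isHermitian.eq, hP1 k, Complex.one_re] at h
    have h1 : ‖P k i j‖ ^ 2 ≤ 1 := by
      rw [h]
      exact (Finset.single_le_sum (f := fun j => ‖P k i j‖ ^ 2) (fun _ _ => sq_nonneg _)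
        (Finset.mem_univ j)).trans (Finset.single_le_sum
          (f := fun i => ∑ j, ‖P k i j‖ ^ 2) (fun _ _ => by positivity) (Finset.mem_univ i))
    rw [mem_closedBall_zero_iff]
    exact (sq_le_one_iff₀ (norm_nonneg _)).1 h1
  have : FirstCountableTopology (Matrix m m ℂ) :=
    inferInstanceAs (FirstCountableTopology (m → m → ℂ))
  -- Pairs are extracted so that consecutive square roots converge along the same subsequence.
  obtain ⟨⟨R, S⟩, -, ψ, hψ, hlim⟩ := (hK.prod hK).tendsto_subseq
    (x := fun j => (P (φ j), P (φ j + 1))) fun j => ⟨hmem _, hmem _⟩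
  rw [Prod.tendsto_iff] at hlim
  refine ⟨R, ψ, hψ, hlim.1, ?_⟩
  exact averageProjection_eq_of_tendsto hG hP hP1 hstep (φ := φ ∘ ψ)
    (hφ.comp hψ).tendsto_atTop hlim.1 hlim.2

end Dynamics

end PavonFerrante

namespace PavonFerrante

open Matrix MeasureTheory Filter Topology Polynomial

/-! ### Zeros and log-integrability of functionals of the transfer function. -/

section Transfer

variable {n : ℕ} {A : Matrix (Fin n) (Fin n) ℂ} {B : Fin n → ℂ}

lemma notMem_spectrum_of_norm_eq_one (hA : SchurStable A) {z : ℂ} (hz : ‖z‖ = 1) :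
    z ∉ spectrum ℂ A := fun h => (hA z h).ne hz

lemma isUnit_smul_one_sub {z : ℂ} (hz : z ∉ spectrum ℂ A) :
    IsUnit (z • (1 : Matrix (Fin n) (Fin n) ℂ) - A) := by
  rw [spectrum.notMem_iff, Algebra.algebraMap_eq_smul_one] at hz
  exact hz

lemma det_smul_one_sub (z : ℂ) :
    (z • (1 : Matrix (Fin n) (Fin n) ℂ) - A).det = A.charpoly.eval z := by
  rw [eval_charpoly, scalar_apply, smul_one_eq_diagonal]

lemma charpoly_eval_ne_zero {z : ℂ} (hz : z ∉ spectrum ℂ A) : A.charpoly.eval z ≠ 0 := by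
  rw [← det_smul_one_sub]
  exact ((isUnit_iff_isUnit_det _).1 (isUnit_smul_one_sub hz)).ne_zero

/-- The functionals of the transfer function are rational functions. -/
lemma exists_dotProduct_transfer_eq_div (A : Matrix (Fin n) (Fin n) ℂ) (B v : Fin n → ℂ) :
    ∃ q : ℂ[X], ∀ z, v ⬝ᵥ transfer A B z = q.eval z / A.charpoly.eval z := by
  refine ⟨∑ i, ∑ j, C (v i * B j) * A.charmatrix.adjugate i j, fun z => ?_⟩
  have h1 : (evalRingHom z).mapMatrix A.charmatrix = z • (1 : Matrix (Fin n) (Fin n) ℂ) - A := by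
    ext i j
    rcases eq_or_ne i j with rfl | hij
    · simp [charmatrix_apply_eq]
    · simp [hij]
  have h2 : ∀ i j, (A.charmatrix.adjugate i j).eval z
      = (z • (1 : Matrix (Fin n) (Fin n) ℂ) - A).adjugate i j := fun i j => by
    rw [← h1, ← RingHom.map_adjugate]; rfl
  simp only [transfer, inv_def, det_smul_one_sub, Ring.inverse_eq_inv', eval_finsetSum, eval_mul,
    eval_C, h2, dotProduct, mulVec, Matrix.smul_apply, smul_eq_mul, Finset.mul_sum,
    Finset.sum_div]
  refine Finset.sum_congr rfl fun i _ => Finset.sum_congr rfl fun j _ => ?_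
  ring

lemma sub_smul_one_mulVec_transfer {z : ℂ} (hz : z ∉ spectrum ℂ A) :
    (A - z • (1 : Matrix (Fin n) (Fin n) ℂ)) *ᵥ transfer A B z = -B := by
  rw [transfer, mulVec_mulVec, ← neg_sub, Matrix.neg_mul, mul_nonsing_inv _
    ((isUnit_iff_isUnit_det _).1 (isUnit_smul_one_sub hz)), neg_mulVec, one_mulVec]

/-- The coefficient vector of `r` lies in the kernel of the reachability matrix, which has full
rank. -/
lemma eq_zero_of_aeval_mulVec_eq_zero (hAB : Reachable A B) {r : ℂ[X]} (hr : r.degree < n)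
    (h : aeval A r *ᵥ B = 0) : r = 0 := by
  set M : Matrix (Fin n) (Fin n) ℂ := of fun i k : Fin n => ((A ^ (k : ℕ)).mulVec B) i with hM
  have hinj : Function.Injective M.mulVec := by
    rw [mulVec_injective_iff, linearIndependent_iff_card_eq_finrank_span, Set.finrank,
      ← rank_eq_finrank_span_cols, Fintype.card_fin]
    exact hAB.symm
  by_contra hr0
  have hnat : r.natDegree < n := (natDegree_lt_iff_degree_lt hr0).2 hr
  have h1 : M *ᵥ (fun k : Fin n => r.coeff k) = 0 := by
    rw [← h, aeval_eq_sum_range' hnat, ← Fin.sum_univ_eq_sum_range (fun i => r.coeff i • A ^ i),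
      sum_mulVec]
    ext i
    simp only [hM, mulVec, dotProduct, of_apply, Finset.sum_apply, Matrix.smul_apply, smul_eq_mul,
      Finset.sum_mul]
    refine Finset.sum_congr rfl fun k _ => Finset.sum_congr rfl fun j _ => ?_
    ring
  have h2 := hinj (h1.trans (mulVec_zero M).symm)
  refine hr0 (ext fun k => ?_)
  by_cases hk : k < n
  · simpa using congrFun h2 ⟨k, hk⟩
  · exact coeff_eq_zero_of_natDegree_lt (by omega)

/-- For a reachable pair the transfer function takes linearly independent values at `n` distinct
points. -/
lemma eq_zero_of_dotProduct_transfer_eq_zero (hAB : Reachable A B) {z : Fin n → ℂ}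
    (hz : Function.Injective z) (hzA : ∀ i, z i ∉ spectrum ℂ A) {v : Fin n → ℂ}
    (hv : ∀ i, v ⬝ᵥ transfer A B (z i) = 0) : v = 0 := by
  by_contra hv0
  set M : Matrix (Fin n) (Fin n) ℂ := of fun i => transfer A B (z i)
  have hdet : M.det = 0 := exists_mulVec_eq_zero_iff.1 ⟨v, hv0, by
    ext i; rw [Pi.zero_apply, ← hv i, dotProduct_comm]; rfl⟩
  obtain ⟨c, hc0, hc⟩ := exists_vecMul_eq_zero_iff.2 hdet
  set N : Fin n → ℂ[X] := fun i => Lagrange.nodal (Finset.univ.erase i) z with hN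
  -- The product of all `A - z j` cancels the resolvent at `z i`. Applied to a dependency `∑ c i G(z
  -- i) = 0`, it gives a polynomial of degree below `n` annihilating `B`, hence zero; its value at
  -- `z i` is a nonzero multiple of `c i`.
  have hnodal : ∀ i, aeval A (Lagrange.nodal Finset.univ z) *ᵥ transfer A B (z i)
      = -(aeval A (N i) *ᵥ B) := fun i => by
    rw [Lagrange.nodal_eq_mul_nodal_erase (Finset.mem_univ i), mul_comm, map_mul, ← mulVec_mulVec,
      map_sub, aeval_X, aeval_C, Algebra.algebraMap_eq_smul_one,
      sub_smul_one_mulVec_transfer (hzA i), mulVec_neg]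
  have hr : aeval A (∑ i, C (c i) * N i) *ᵥ B = 0 := by
    have h1 : ∑ i, c i • transfer A B (z i) = 0 := by
      rw [← hc, vecMul_eq_sum]; rfl
    have h2 := congrArg (fun w => aeval A (Lagrange.nodal Finset.univ z) *ᵥ w) h1
    simp only [mulVec_sum, mulVec_smul, hnodal, mulVec_zero, smul_neg, Finset.sum_neg_distrib,
      neg_eq_zero] at h2
    rw [map_sum, sum_mulVec, ← h2]
    refine Finset.sum_congr rfl fun i _ => ?_
    rw [map_mul, aeval_C, Algebra.algebraMap_eq_smul_one, smul_mul_assoc, Matrix.one_mul,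
      smul_mulVec]
  have hdeg : (∑ i, C (c i) * N i).degree < n := by
    refine mem_degreeLT.1 (Submodule.sum_mem _ fun i _ => mem_degreeLT.2 ?_)
    rw [← smul_eq_C_mul]
    refine (degree_smul_le _ _).trans_lt ?_
    have hn := i.pos
    rw [hN, Lagrange.degree_nodal, Finset.card_erase_of_mem (Finset.mem_univ i), Finset.card_univ,
      Fintype.card_fin]
    exact_mod_cast Nat.sub_lt hn one_pos
  have h0 := eq_zero_of_aeval_mulVec_eq_zero hAB hdeg hr
  refine hc0 (funext fun i => ?_)
  have h1 := congrArg (eval (z i)) h0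
  rw [eval_finsetSum, Finset.sum_eq_single i] at h1
  · rw [eval_mul, eval_C, eval_zero, mul_eq_zero] at h1
    refine h1.resolve_right ?_
    rw [hN, Lagrange.eval_nodal]
    exact Finset.prod_ne_zero_iff.2 fun j hj =>
      sub_ne_zero.2 (hz.ne (Finset.ne_of_mem_erase hj).symm)
  · intro j _ hj
    rw [eval_mul, hN, Lagrange.eval_nodal_at_node (Finset.mem_erase.2 ⟨hj.symm, Finset.mem_univ i⟩),
      mul_zero]
  · simp

lemma finite_zeros_dotProduct_transfer (hA : SchurStable A) (hAB : Reachable A B)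
    {v : Fin n → ℂ} (hv : v ≠ 0) : {z : ℂ | ‖z‖ = 1 ∧ v ⬝ᵥ transfer A B z = 0}.Finite := by
  by_contra hinf
  let e := Set.Infinite.natEmbedding _ hinf
  refine hv (eq_zero_of_dotProduct_transfer_eq_zero hAB (z := fun i => (e i : ℂ)) ?_ ?_ ?_)
  · intro i j hij
    exact Fin.ext (e.injective (Subtype.ext hij))
  · exact fun i => notMem_spectrum_of_norm_eq_one hA (e i).2.1
  · exact fun i => (e i).2.2

lemma continuous_transferCircle (hA : SchurStable A) : Continuous (transferCircle A B) := by
  refine continuous_pi fun i => ?_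
  obtain ⟨q, hq⟩ := exists_dotProduct_transfer_eq_div A B (Pi.single i 1)
  have h : ∀ θ, transferCircle A B θ i
      = q.eval (Circle.exp θ : ℂ) / A.charpoly.eval (Circle.exp θ : ℂ) := fun θ => by
    rw [← hq, single_one_dotProduct]; rfl
  simp only [h]
  have hc : Continuous fun θ : ℝ => (Circle.exp θ : ℂ) := by fun_prop
  exact (q.continuous.comp hc).div (A.charpoly.continuous.comp hc) fun θ =>
    charpoly_eval_ne_zero (notMem_spectrum_of_norm_eq_one hA (Circle.norm_coe _))

lemma transferCircle_periodic : Function.Periodic (transferCircle A B) (2 * Real.pi) := fun θ => by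
  simp only [transferCircle, Circle.periodic_exp θ]

/-- The functional is rational, hence meromorphic, so its zeros and poles contribute only integrable
logarithmic singularities. Periodicity moves the interval from `[0, 2π]` to `[-π, π]`. -/
lemma intervalIntegrable_log_dotProduct_transferCircle (v : Fin n → ℂ) :
    IntervalIntegrable (fun θ => Real.log ‖v ⬝ᵥ transferCircle A B θ‖) volume
      (-Real.pi) Real.pi := by
  obtain ⟨q, hq⟩ := exists_dotProduct_transfer_eq_div A B v
  have hmer : MeromorphicOn (fun z => q.eval z / A.charpoly.eval z)
      (Metric.sphere (0 : ℂ) |1|) := fun z _ =>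
    ((AnalyticOnNhd.eval_polynomial q z trivial).meromorphicAt).div
      ((AnalyticOnNhd.eval_polynomial A.charpoly z trivial).meromorphicAt)
  have h1 := hmer.circleIntegrable_log_norm
  have h2 : IntervalIntegrable (fun θ => Real.log ‖v ⬝ᵥ transferCircle A B θ‖) volume
      0 (0 + 2 * Real.pi) := by
    rw [zero_add]
    refine IntervalIntegrable.congr ?_ h1
    intro θ _
    simp only [transferCircle, hq, circleMap_zero, Complex.ofReal_one, one_mul, Circle.coe_exp]
  refine Function.Periodic.intervalIntegrable ?_ (by positivity) h2 _ _
  intro θ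
  simp only [transferCircle_periodic θ]

end Transfer

end PavonFerrante

namespace PavonFerrante

open Matrix MeasureTheory Filter Topology

/-! ### The spectral measure and the link with the iteration map. -/

section SpectralMeasure

variable {Ψ : Circle → ℝ}

/-- The density of the spectral measure `Ψ dθ / 2π`. -/
noncomputable def spectralDensity (Ψ : Circle → ℝ) (θ : ℝ) : NNReal :=
  ((2 * Real.pi)⁻¹ * Ψ (Circle.exp θ)).toNNReal

/-- The measure `Ψ dθ / 2π` on `(-π, π]`. -/
noncomputable def spectralMeasure (Ψ : Circle → ℝ) : Measure ℝ :=
  (volume.restrict (Set.Ioc (-Real.pi) Real.pi)).withDensity fun θ =>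
    (spectralDensity Ψ θ : ENNReal)

lemma continuous_spectralDensity (hΨ : IsNormalizedDensity Ψ) :
    Continuous (spectralDensity Ψ) := by
  have := hΨ.continuous
  unfold spectralDensity
  fun_prop

lemma coe_spectralDensity (hΨ : IsNormalizedDensity Ψ) (θ : ℝ) :
    (spectralDensity Ψ θ : ℝ) = (2 * Real.pi)⁻¹ * Ψ (Circle.exp θ) :=
  Real.coe_toNNReal _ (mul_nonneg (by positivity) (hΨ.pos _).le)

lemma neg_pi_le_pi : -Real.pi ≤ Real.pi := by linarith [Real.pi_pos]

lemma integral_spectralMeasure (hΨ : IsNormalizedDensity Ψ) (f : ℝ → ℂ) :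
    ∫ θ, f θ ∂spectralMeasure Ψ
      = (2 * (Real.pi : ℂ))⁻¹ * ∫ θ in (-Real.pi)..Real.pi, (Ψ (Circle.exp θ) : ℂ) * f θ := by
  rw [spectralMeasure, integral_withDensity_eq_integral_smul
    (continuous_spectralDensity hΨ).measurable, intervalIntegral.integral_of_le neg_pi_le_pi,
    ← integral_const_mul]
  refine integral_congr_ae (ae_of_all _ fun θ => ?_)
  simp only [NNReal.smul_def, coe_spectralDensity hΨ, Complex.real_smul]
  push_cast
  ring

lemma isProbabilityMeasure_spectralMeasure (hΨ : IsNormalizedDensity Ψ) :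
    IsProbabilityMeasure (spectralMeasure Ψ) := by
  constructor
  have hi : Integrable (fun θ => (spectralDensity Ψ θ : ℝ))
      (volume.restrict (Set.Ioc (-Real.pi) Real.pi)) := by
    have hc : Continuous fun θ => (spectralDensity Ψ θ : ℝ) :=
      NNReal.continuous_coe.comp (continuous_spectralDensity hΨ)
    exact (hc.intervalIntegrable (-Real.pi) Real.pi).1
  rw [spectralMeasure, withDensity_apply _ MeasurableSet.univ, Measure.restrict_univ]
  have h := ofReal_integral_eq_lintegral_ofReal hi (ae_of_all _ fun θ => NNReal.coe_nonneg _)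
  simp only [ENNReal.ofReal_coe_nnreal] at h
  rw [← h]
  simp only [coe_spectralDensity hΨ]
  rw [integral_const_mul, ← intervalIntegral.integral_of_le neg_pi_le_pi, hΨ.integral_eq_one,
    ENNReal.ofReal_one]

variable {n : ℕ} {A : Matrix (Fin n) (Fin n) ℂ} {B : Fin n → ℂ}

lemma isNondegenerate_transferCircle (hA : SchurStable A) (hAB : Reachable A B)
    (hΨ : IsNormalizedDensity Ψ) :
    IsNondegenerate (spectralMeasure Ψ) (transferCircle A B) where
  measurable := (continuous_transferCircle hA).measurable
  bounded := by
    have hc : Continuous fun θ => sqNorm (transferCircle A B θ) :=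
      continuous_sqNorm.comp (continuous_transferCircle hA)
    have hp : Function.Periodic (fun θ => sqNorm (transferCircle A B θ)) (2 * Real.pi) :=
      fun θ => by simp only [transferCircle_periodic θ]
    obtain ⟨C, hC⟩ := (hp.compact_of_continuous (by positivity) hc).bddAbove
    exact ⟨C, fun θ => hC ⟨θ, rfl⟩⟩
  ae_ne_zero v hv := by
    refine (withDensity_absolutelyContinuous _ _).ae_le ?_
    refine (ae_restrict_iff' measurableSet_Ioc).2 ?_
    -- `Circle.exp` is injective on `(-π, π]`, so finiteness carries over from the circle.
    have hfin : {θ | θ ∈ Set.Ioc (-Real.pi) Real.pi ∧ v ⬝ᵥ transferCircle A B θ = 0}.Finite := by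
      refine Set.Finite.of_finite_image (f := fun θ => (Circle.exp θ : ℂ))
        ((finite_zeros_dotProduct_transfer hA hAB hv).subset ?_) ?_
      · rintro _ ⟨θ, ⟨-, hθ⟩, rfl⟩
        exact ⟨Circle.norm_coe _, hθ⟩
      · rintro θ ⟨hθ, -⟩ θ' ⟨hθ', -⟩ h
        rw [← Circle.arg_exp hθ.1 hθ.2, ← Circle.arg_exp hθ'.1 hθ'.2]
        exact congrArg Complex.arg h
    filter_upwards [hfin.measure_zero volume |> compl_mem_ae_iff.2] with θ h1 h2 h3
    exact h1 ⟨h2, h3⟩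
  integrable_log v _ := by
    rw [spectralMeasure, integrable_withDensity_iff_integrable_smul
      (continuous_spectralDensity hΨ).measurable]
    have h := intervalIntegrable_log_dotProduct_transferCircle (A := A) (B := B) v
    have hc : Continuous fun θ => (spectralDensity Ψ θ : ℝ) :=
      NNReal.continuous_coe.comp (continuous_spectralDensity hΨ)
    exact (h.continuousOn_mul hc.continuousOn).1

lemma sqrt_posSemidef (L : Matrix (Fin n) (Fin n) ℂ) : (CFC.sqrt L).PosSemidef :=
  nonneg_iff_posSemidef.1 (CFC.sqrt_nonneg L)

lemma sqrt_mul_sqrt {L : Matrix (Fin n) (Fin n) ℂ} (hL : L.PosSemidef) :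
    CFC.sqrt L * CFC.sqrt L = L :=
  CFC.sqrt_mul_sqrt_self L (nonneg_iff_posSemidef.2 hL)

lemma quadForm_eq_sqNorm {L : Matrix (Fin n) (Fin n) ℂ} (hL : L.PosSemidef) (θ : ℝ) :
    quadForm A B L θ = sqNorm (CFC.sqrt L *ᵥ transferCircle A B θ) := by
  rw [sqNorm_mulVec, (sqrt_posSemidef L).isHermitian.eq, sqrt_mul_sqrt hL, quadForm]

/-- The denominator is `|Λ^{1/2} G|²`, so the integrand is `Ψ` times a projection. -/
lemma iterMap_eq_averageProjection (hΨ : IsNormalizedDensity Ψ)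
    {L : Matrix (Fin n) (Fin n) ℂ} (hL : L.PosSemidef) :
    iterMap A B Ψ L
      = averageProjection (spectralMeasure Ψ) (transferCircle A B) (CFC.sqrt L) := by
  ext i j
  simp only [iterMap, averageProjection, of_apply, integral_spectralMeasure hΨ]
  congr 1
  refine intervalIntegral.integral_congr fun θ _ => ?_
  have h : star (transferCircle A B θ) ᵥ* CFC.sqrt L
      = star (CFC.sqrt L *ᵥ transferCircle A B θ) := by
    rw [star_mulVec, (sqrt_posSemidef L).isHermitian.eq]
  simp only [integrand, quadForm_eq_sqNorm hL, mul_vecMulVec, vecMulVec_mul, h, Matrix.smul_apply,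
    vecMulVec_apply, smul_eq_mul, Pi.star_apply]
  ring

lemma sqrt_ne_zero {L : Matrix (Fin n) (Fin n) ℂ} (hL : L ∈ densityMatrices n) :
    CFC.sqrt L ≠ 0 := by
  intro h
  have h1 := hL.2
  rw [← sqrt_mul_sqrt hL.1, h] at h1
  simp at h1

lemma iterMap_mem_densityMatrices (hA : SchurStable A) (hAB : Reachable A B)
    (hΨ : IsNormalizedDensity Ψ) {L : Matrix (Fin n) (Fin n) ℂ} (hL : L ∈ densityMatrices n) :
    iterMap A B Ψ L ∈ densityMatrices n := by
  have := isProbabilityMeasure_spectralMeasure hΨ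
  have hG := isNondegenerate_transferCircle hA hAB hΨ
  rw [iterMap_eq_averageProjection hΨ hL.1]
  exact ⟨averageProjection_posSemidef hG.measurable _,
    trace_averageProjection hG (sqrt_ne_zero hL)⟩

lemma continuous_frobNorm : Continuous (frobNorm : Matrix (Fin n) (Fin n) ℂ → ℝ) := by
  unfold frobNorm
  fun_prop

end SpectralMeasure

end PavonFerrante

/-! ### Convergence to the fixed point set. -/

open PavonFerrante Filter Topology

theorem theorem2 (n : ℕ) (A : Matrix (Fin n) (Fin n) ℂ) (B : Fin n → ℂ)
    (hA : PavonFerrante.SchurStable A) (hAB : PavonFerrante.Reachable A B)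
    (Ψ : Circle → ℝ) (hΨ : PavonFerrante.IsNormalizedDensity Ψ)
    (L : ℕ → Matrix (Fin n) (Fin n) ℂ)
    (hL0 : L 0 ∈ PavonFerrante.densityMatrices n)
    (hL : ∀ k : ℕ, L (k + 1) = PavonFerrante.iterMap A B Ψ (L k)) :
    PavonFerrante.ConvergesToSet L (PavonFerrante.fixedPointSet A B Ψ) := by
  have := isProbabilityMeasure_spectralMeasure hΨ
  have hG := isNondegenerate_transferCircle hA hAB hΨ
  have hmem : ∀ k, L k ∈ densityMatrices n := fun k => by
    induction k with
    | zero => exact hL0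
    | succ k ih => rw [hL]; exact iterMap_mem_densityMatrices hA hAB hΨ ih
  have hsq : ∀ k, CFC.sqrt (L k) * CFC.sqrt (L k) = L k := fun k => sqrt_mul_sqrt (hmem k).1
  intro ε hε
  -- Otherwise some subsequence stays at distance at least `ε` from every fixed point, yet a further
  -- subsequence converges to one.
  by_contra! hcon
  obtain ⟨φ, hφ, hfar⟩ := extraction_of_frequently_atTop
    (P := fun k => ∀ T ∈ fixedPointSet A B Ψ, ε ≤ frobNorm (L k - T))
    (frequently_atTop.2 hcon)
  obtain ⟨R, ψ, -, hlim, hR, hR1, hfix⟩ := exists_subseq_tendsto_fixedPoint hG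
    (P := fun k => CFC.sqrt (L k)) (fun k => sqrt_posSemidef _)
    (fun k => by rw [hsq]; exact (hmem k).2)
    (fun k => by rw [hsq, hL, iterMap_eq_averageProjection hΨ (hmem k).1]) hφ
  have hRR : (R * R).PosSemidef := by
    have := Matrix.posSemidef_conjTranspose_mul_self R
    rwa [hR.isHermitian.eq] at this
  have hT : R * R ∈ fixedPointSet A B Ψ := by
    refine ⟨⟨hRR, hR1⟩, ?_⟩
    rw [iterMap_eq_averageProjection hΨ hRR,
      CFC.sqrt_unique rfl (Matrix.nonneg_iff_posSemidef.2 hR), hfix]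
  have hc : Continuous fun X : Matrix (Fin n) (Fin n) ℂ => frobNorm (X * X - R * R) :=
    continuous_frobNorm.comp (by fun_prop)
  have h0 : Tendsto (fun j => frobNorm (L (φ (ψ j)) - R * R)) atTop (𝓝 0) := by
    have := (hc.tendsto R).comp hlim
    simp only [Function.comp_def, hsq, sub_self] at this
    simpa [frobNorm] using this
  exact absurd (ge_of_tendsto' h0 fun j => hfar (ψ j) _ hT) (not_le.2 hε)
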